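/- Let $X$ be a real Banach space with dual $X^*$, and let $f\colon X\to X$ be nonexpansive, i.e. $\|f(x)-f(y)\|\le\|x-y\|$ for all $x,y\in X$. For $x \in X$ let $J(x)=\{x^*\in X^*:\|x^*\|=\|x\|,\ \langle x,x^*\rangle=\|x\|\,\|x^*\|\}$, and for $\delta>0$ let $F_\delta(f)=\{x\in X:\|f(x)-x\|\le\delta\}$. Consider the following conditions on $f$. (a) $F_\delta(f)$ is bounded for every $\delta>0$. (b) For every $u\in X$ the map $f+u$ has a nonempty and bounded set of fixed points. (c) $f-\mathrm{id}$ maps onto $X$. (d) The range of $f-\mathrm{id}$ is dense in $X$. (e) For every $x\in X$ with $\|x\|=1$ there is $x^*\in J(x)$ such that $\lim_{t\to\infty}\langle f(tx)-tx,x^*\rangle=-\infty$. Then: 1. (a) implies (d), (b) implies (c), and (d) implies (e). 2. If $X$ has the fixed point property (every nonexpansive self-map of a nonempty closed bounded convex subset of $X$ has a fixed point), then (a) implies (b). 3. If $X$ is uniformly smooth (i.e. $X^*$ is uniformly convex), then (d) and (e) are equivalent. 4. If $X$ is a Hilbert space, then (b) and (c) are equivalent. 5. If $X$ is finite-dimensional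 and its norm is smooth (i.e. $X^*$ is strictly convex) or polyhedral (i.e. the closed unit ball has finitely many extreme points), then all five conditions are equivalent. -/

import Mathlib

open Filter Metric

namespace Displacement

section Banach

variable (X : Type*) [NormedAddCommGroup X] [NormedSpace ℝ X]

/-- A space is smooth when its dual space is strictly convex. -/
def IsSmooth : Prop := StrictConvexSpace ℝ (StrongDual ℝ X)

/-- A space is uniformly smooth when its dual space is uniformly convex. -/
def IsUniformlySmooth : Prop := UniformConvexSpace (StrongDual ℝ X)

/-- The norm is polyhedral when the closed unit ball has finitely many extreme points
(used for finite-dimensional spaces only). -/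
def IsPolyhedral : Prop := (Set.extremePoints ℝ (closedBall (0 : X) 1)).Finite

/-- The norm and the real vector space structure of `X` come from an inner product
(so that a complete `X` is a Hilbert space). -/
def IsInnerProduct : Prop :=
  ∃ I : InnerProductSpace ℝ X, I.toNormedSpace = ‹NormedSpace ℝ X›

/-- The fixed point property: every nonexpansive self-map of a nonempty closed, bounded, convex
subset has a fixed point. -/
def HasFixedPointProperty : Prop :=
  ∀ C : Set X, C.Nonempty → IsClosed C → Bornology.IsBounded C → Convex ℝ C →
    ∀ g : C → C, LipschitzWith 1 g → ∃ x : C, g x = x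

end Banach

section Maps

variable {X : Type*} [NormedAddCommGroup X]

/-- The set of `δ`-approximate fixed points of `f`. -/
def approxFixedPoints (f : X → X) (δ : ℝ) : Set X := {x | ‖f x - x‖ ≤ δ}

/-- The set-valued (normalized) duality map. -/
def dualityMap [NormedSpace ℝ X] (x : X) : Set (StrongDual ℝ X) :=
  {φ | ‖φ‖ = ‖x‖ ∧ φ x = ‖x‖ * ‖φ‖}

/-- Condition (a): all approximate fixed point sets are bounded. -/
def BoundedApproxFixedPoints (f : X → X) : Prop :=
  ∀ δ : ℝ, 0 < δ → Bornology.IsBounded (approxFixedPoints f δ)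

/-- Condition (b): every `f + u` has a nonempty and bounded set of fixed points. -/
def BoundedFixedPointsOfTranslates (f : X → X) : Prop :=
  ∀ u : X, (Function.fixedPoints (fun x => f x + u)).Nonempty ∧
    Bornology.IsBounded (Function.fixedPoints (fun x => f x + u))

/-- Condition (c): `f - id` maps onto `X`. -/
def SurjectiveDisplacement (f : X → X) : Prop := Function.Surjective (fun x => f x - x)

/-- Condition (d): the range of `f - id` is dense in `X`. -/
def DenseDisplacement (f : X → X) : Prop := Dense (Set.range (fun x => f x - x))

/-- Condition (e): for every unit vector `x` some functional in the duality set of `x` tends to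
`-∞` on `f (t x) - t x` as `t → ∞`. -/
def DirectionalLimits [NormedSpace ℝ X] (f : X → X) : Prop :=
  ∀ x : X, ‖x‖ = 1 → ∃ φ ∈ dualityMap x,
    Tendsto (fun t : ℝ => φ (f (t • x) - t • x)) atTop atBot

end Maps

end Displacement

/-!
All implications rest on one inequality, `apply_displacement_le`: if `φ` has norm at most one and
norms `a - b` up to an error, then `φ (f a - a) ≤ φ (f b - b)` up to the same error. In particular,
along a ray the displacement `f x - x` decreases when it is tested against a functional norming the
direction of the ray.

*Bounded approximate fixed points.* The solutions `x` of `x = s f(x)`, `s < 1`, given by Banach's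
theorem, have bounded displacement `(1 - s) f(x)`. If approximate fixed point sets are bounded,
these solutions stay bounded and their displacement tends to zero as `s → 1`; applied to all
translates of `f` this gives a dense range. For the same reason the orbit of `0` is bounded, and the
points asymptotically within a given distance of it form a closed bounded convex invariant set, to
which the fixed point property applies.

*From a dense range to limits along rays.* If `v = f y - y` is close to `-N x`, a weak* limit `φ` of
functionals norming `r x - y` norms `x` (`exists_norming_asymptotic`), and testing with `φ` gives a
limit of at most about `-N` along the ray of `x`. The combination of such functionals with weights
`2 ^ (-n - 1)` has limit `-∞`.

*Uniformly smooth spaces.* If the displacement of a translate of `f` had norm at least `d > 0`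
everywhere, the functionals norming the solutions of `x = s f(x)` would have a weak* limit `φ` with
`φ (f x - x) ≥ d` for all `x` (`exists_le_apply_displacement`). The space is reflexive, by a form of
the Milman–Pettis theorem, so `φ` attains its norm at some unit vector `z`; by smoothness `φ` is,
up to scaling, the only functional norming `z`, and the condition on limits fails along the ray
of `z`.

*Hilbert spaces.* Monotonicity of `id - f` bounds `⟪x, v⟫` from below over fixed points `x`, for
each `v` in a translate of the range; surjectivity and the uniform boundedness principle do the
rest.

*Finite dimension.* Given approximate fixed points escaping to infinity, a ray is found along which
every admissible functional is bounded below on displacements. For a smooth norm it is the ray of a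
limit direction. For a polyhedral norm, it is spanned by the sum of those extreme points of the unit
ball whose coefficients in a representation of the approximate fixed points tend to infinity.
-/

open scoped Topology

namespace Displacement

/-! ### Norming functionals and weak* limits -/

section Functionals

variable {X : Type*} [NormedAddCommGroup X] [NormedSpace ℝ X]

theorem le_norm_of_norm_le_one {φ : StrongDual ℝ X} (hφ : ‖φ‖ ≤ 1) (w : X) : φ w ≤ ‖w‖ :=
  (le_abs_self _).trans (by simpa using φ.le_of_opNorm_le hφ w)

theorem neg_norm_le_of_norm_le_one {φ : StrongDual ℝ X} (hφ : ‖φ‖ ≤ 1) (w : X) : -‖w‖ ≤ φ w := by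
  have := le_norm_of_norm_le_one hφ (-w)
  rw [map_neg, norm_neg] at this
  linarith

theorem norm_eq_one_of_apply_eq_one {φ : StrongDual ℝ X} (hφ : ‖φ‖ ≤ 1) {x : X} (hx : ‖x‖ = 1)
    (h : φ x = 1) : ‖φ‖ = 1 := by
  refine le_antisymm hφ ?_
  have := φ.le_opNorm x
  rw [h, hx] at this
  simpa using this

/-- For a unit vector the duality map consists of the norming functionals in the unit ball. -/
theorem mem_dualityMap_iff {φ : StrongDual ℝ X} {x : X} (hx : ‖x‖ = 1) :
    φ ∈ dualityMap x ↔ ‖φ‖ ≤ 1 ∧ φ x = 1 := by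
  constructor
  · rintro ⟨h1, h2⟩
    rw [h1, hx] at h2
    exact ⟨by rw [h1, hx], by simpa using h2⟩
  · rintro ⟨h1, h2⟩
    have := norm_eq_one_of_apply_eq_one h1 hx h2
    exact ⟨by rw [this, hx], by rw [this, hx, h2]; norm_num⟩

/-- The Banach–Alaoglu theorem in terms of ultrafilters. -/
theorem exists_weakStar_limit {ι : Type*} (U : Ultrafilter ι) (φ : ι → StrongDual ℝ X)
    (hφ : ∀ i, ‖φ i‖ ≤ 1) :
    ∃ ψ : StrongDual ℝ X, ‖ψ‖ ≤ 1 ∧ ∀ w, Tendsto (fun i => φ i w) U (𝓝 (ψ w)) := by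
  have hc := WeakDual.isCompact_closedBall (𝕜 := ℝ) (0 : StrongDual ℝ X) 1
  obtain ⟨ψ, hψ, hle⟩ := hc.ultrafilter_le_nhds (U.map fun i => StrongDual.toWeakDual (φ i)) (by
    rw [le_principal_iff, Ultrafilter.mem_coe, Ultrafilter.mem_map]
    exact Filter.univ_mem' fun i => by simpa using hφ i)
  refine ⟨WeakDual.toStrongDual ψ, by simpa using hψ, fun w => ?_⟩
  have h1 : Tendsto (fun i => StrongDual.toWeakDual (φ i)) U (𝓝 ψ) := hle
  exact ((WeakDual.eval_continuous w).tendsto ψ).comp h1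

end Functionals

/-! ### Nonexpansive maps, approximate fixed points and the fixed point property -/

section Nonexpansive

variable {X : Type*} [NormedAddCommGroup X]

theorem norm_map_sub_le {f : X → X} (hf : LipschitzWith 1 f) (a b : X) :
    ‖f a - f b‖ ≤ ‖a - b‖ := by
  simpa using hf.norm_sub_le a b

theorem lipschitzWith_add_const {f : X → X} (hf : LipschitzWith 1 f) (u : X) :
    LipschitzWith 1 fun x => f x + u :=
  LipschitzWith.of_dist_le_mul fun a b => by simpa using hf.dist_le_mul a b

/-- It suffices to approximate fixed points of all translates. -/
theorem denseDisplacement_of_forall_translate {f : X → X}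
    (h : ∀ u : X, ∀ ε > 0, ∃ x, ‖(f x + u) - x‖ < ε) : DenseDisplacement f := by
  intro v
  rw [Metric.mem_closure_iff]
  intro ε hε
  obtain ⟨x, hx⟩ := h (-v) ε hε
  refine ⟨_, ⟨x, rfl⟩, ?_⟩
  have h1 : f x - x - v = f x + -v - x := by abel
  change dist v (f x - x) < ε
  rwa [dist_comm, dist_eq_norm, h1]

theorem isBounded_approxFixedPoints_translate {f : X → X} (h : BoundedApproxFixedPoints f) (u : X)
    {δ : ℝ} (hδ : 0 < δ) : Bornology.IsBounded {x | ‖(f x + u) - x‖ ≤ δ} := by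
  refine (h (δ + ‖u‖) (by positivity)).subset fun x hx => ?_
  have : f x - x = (f x + u - x) - u := by abel
  change ‖f x - x‖ ≤ _
  rw [this]
  exact (norm_sub_le _ _).trans (by gcongr; exact hx)

theorem BoundedFixedPointsOfTranslates.surjectiveDisplacement {f : X → X}
    (h : BoundedFixedPointsOfTranslates f) : SurjectiveDisplacement f := by
  intro v
  obtain ⟨x, hx⟩ := (h (-v)).1
  refine ⟨x, ?_⟩
  have hx' : f x + -v = x := hx
  change f x - x = v
  nth_rw 2 [← hx']
  abel

theorem SurjectiveDisplacement.denseDisplacement {f : X → X}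
    (h : SurjectiveDisplacement f) : DenseDisplacement f := h.denseRange

variable [NormedSpace ℝ X]

/-- Accretivity of `id - f`, with an error term measuring how far `φ` is from norming `a - b`. -/
theorem apply_displacement_le {f : X → X} (hf : LipschitzWith 1 f) {φ : StrongDual ℝ X}
    (hφ : ‖φ‖ ≤ 1) (a b : X) : φ (f a - a) ≤ φ (f b - b) + (‖a - b‖ - φ (a - b)) := by
  have h := (le_norm_of_norm_le_one hφ (f a - f b)).trans (norm_map_sub_le hf a b)
  simp only [map_sub] at h ⊢
  linarith

theorem exists_eq_smul_apply [CompleteSpace X] {f : X → X} (hf : LipschitzWith 1 f) {s : ℝ}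
    (h0 : 0 ≤ s) (h1 : s < 1) : ∃ x, x = s • f x := by
  have hc : ContractingWith ⟨s, h0⟩ fun x => s • f x := by
    refine ⟨by exact_mod_cast h1, LipschitzWith.of_dist_le_mul fun a b => ?_⟩
    rw [dist_smul₀, Real.norm_of_nonneg h0]
    exact mul_le_mul_of_nonneg_left (by simpa using hf.dist_le_mul a b) h0
  exact ⟨_, (hc.fixedPoint_isFixedPt).eq.symm⟩

/-- The displacement of the approximate fixed points `x = s f(x)` stays bounded. -/
theorem norm_displacement_le_of_eq_smul {f : X → X} (hf : LipschitzWith 1 f) {s : ℝ}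
    (h0 : 0 ≤ s) (h1 : s < 1) {x : X} (hx : x = s • f x) :
    ‖f x - x‖ = (1 - s) * ‖f x‖ ∧ (1 - s) * ‖f x‖ ≤ ‖f 0‖ := by
  have h2 : f x - x = (1 - s) • f x := by rw [sub_smul, one_smul, ← hx]
  refine ⟨by rw [h2, norm_smul, Real.norm_of_nonneg (by linarith)], ?_⟩
  have h3 : ‖x‖ = s * ‖f x‖ := by
    conv_lhs => rw [hx]
    rw [norm_smul, Real.norm_of_nonneg h0]
  have h4 := norm_map_sub_le hf x 0
  rw [sub_zero] at h4
  have h5 := norm_sub_norm_le (f x) (f 0)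
  linarith

theorem BoundedApproxFixedPoints.denseDisplacement [CompleteSpace X] {f : X → X}
    (hf : LipschitzWith 1 f) (h : BoundedApproxFixedPoints f) : DenseDisplacement f := by
  refine denseDisplacement_of_forall_translate fun u ε hε => ?_
  set g : X → X := fun x => f x + u with hg
  have hgl : LipschitzWith 1 g := lipschitzWith_add_const hf u
  obtain ⟨R, hR⟩ := (isBounded_approxFixedPoints_translate h u
    (δ := ‖g 0‖ + 1) (by positivity)).exists_norm_le
  have hM : 0 < ‖g 0‖ + |R| + 1 := by positivity
  obtain ⟨τ, hτ0, hτ⟩ : ∃ τ : ℝ, 0 < τ ∧ τ < 1 ∧ τ * (‖g 0‖ + |R| + 1) < ε := by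
    refine ⟨min (1 / 2) (ε / (2 * (‖g 0‖ + |R| + 1))), by positivity,
      (min_le_left _ _).trans_lt (by norm_num), ?_⟩
    calc _ ≤ ε / (2 * (‖g 0‖ + |R| + 1)) * (‖g 0‖ + |R| + 1) := by gcongr; exact min_le_right _ _
      _ = ε / 2 := by field_simp
      _ < ε := by linarith
  obtain ⟨x, hx⟩ := exists_eq_smul_apply hgl (s := 1 - τ) (by linarith) (by linarith)
  obtain ⟨h1, h2⟩ := norm_displacement_le_of_eq_smul hgl (by linarith) (by linarith) hx
  refine ⟨x, ?_⟩
  have hxR : ‖x‖ ≤ R := hR x (by change ‖g x - x‖ ≤ _; linarith)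
  have h3 : ‖g x‖ ≤ ‖g 0‖ + |R| + 1 := by
    have h4 := norm_map_sub_le hgl x 0
    have h5 := norm_sub_norm_le (g x) (g 0)
    rw [sub_zero] at h4
    linarith [le_abs_self R]
  change ‖g x - x‖ < ε
  rw [h1, sub_sub_cancel]
  exact (mul_le_mul_of_nonneg_left h3 hτ0.le).trans_lt hτ.2

/-- A bounded orbit has an asymptotic ball which is closed, bounded, convex and invariant. -/
theorem exists_fixedPoint_of_isBounded_orbit (hX : HasFixedPointProperty X) {g : X → X}
    (hg : LipschitzWith 1 g) {R : ℝ} (hR : ∀ n, ‖g^[n] 0‖ ≤ R) : ∃ x, g x = x := by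
  set C : Set X := {y | ∀ ε > 0, ∀ᶠ n in atTop, ‖g^[n] 0 - y‖ ≤ R + ε} with hC
  have hmem : (0 : X) ∈ C := fun ε hε => Eventually.of_forall fun n => by
    rw [sub_zero]; linarith [hR n]
  have hclosed : IsClosed C := by
    refine isClosed_of_closure_subset fun y hy ε hε => ?_
    obtain ⟨z, hz, hyz⟩ := Metric.mem_closure_iff.1 hy (ε / 2) (half_pos hε)
    filter_upwards [hz (ε / 2) (half_pos hε)] with n hn
    have : g^[n] 0 - y = (g^[n] 0 - z) + (z - y) := by abel
    rw [this]
    rw [dist_comm, dist_eq_norm] at hyz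
    linarith [norm_add_le (g^[n] 0 - z) (z - y)]
  have hbdd : Bornology.IsBounded C := by
    refine (isBounded_iff_forall_norm_le).2 ⟨2 * R + 1, fun y hy => ?_⟩
    obtain ⟨n, hn⟩ := (hy 1 one_pos).exists
    have h1 := norm_sub_norm_le y (g^[n] 0)
    rw [norm_sub_rev] at h1
    linarith [hR n]
  have hconv : Convex ℝ C := by
    intro y hy z hz a b ha hb hab ε hε
    filter_upwards [hy ε hε, hz ε hε] with n h1 h2
    have : g^[n] 0 - (a • y + b • z) = a • (g^[n] 0 - y) + b • (g^[n] 0 - z) := by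
      rw [smul_sub, smul_sub, sub_add_sub_comm, ← add_smul, hab, one_smul]
    rw [this]
    refine (norm_add_le _ _).trans ?_
    rw [norm_smul, norm_smul, Real.norm_of_nonneg ha, Real.norm_of_nonneg hb]
    calc _ ≤ a * (R + ε) + b * (R + ε) := by gcongr
      _ = R + ε := by rw [← add_mul, hab, one_mul]
  have hmaps : ∀ y ∈ C, g y ∈ C := by
    intro y hy ε hε
    rw [← map_add_atTop_eq_nat 1, eventually_map]
    filter_upwards [hy ε hε] with n hn
    rw [Function.iterate_succ_apply']
    exact (norm_map_sub_le hg _ _).trans hn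
  obtain ⟨x, hx⟩ := hX C ⟨0, hmem⟩ hclosed hbdd hconv (fun y => ⟨g y, hmaps y y.2⟩)
    (LipschitzWith.of_dist_le_mul fun a b => hg.dist_le_mul a b)
  exact ⟨x, congrArg Subtype.val hx⟩

theorem BoundedApproxFixedPoints.boundedFixedPointsOfTranslates (hX : HasFixedPointProperty X)
    {f : X → X} (hf : LipschitzWith 1 f) (h : BoundedApproxFixedPoints f) :
    BoundedFixedPointsOfTranslates f := by
  intro u
  have hg := lipschitzWith_add_const hf u
  refine ⟨?_, (isBounded_approxFixedPoints_translate h u one_pos).subset fun x hx => ?_⟩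
  · set g : X → X := fun x => f x + u
    -- the displacement does not increase along orbits, so the orbit of `0` is bounded
    have horb : ∀ n, ‖g (g^[n] 0) - g^[n] 0‖ ≤ ‖g 0‖ + 1 := by
      intro n
      induction n with
      | zero => simp
      | succ n ih =>
        rw [Function.iterate_succ_apply']
        exact (norm_map_sub_le hg _ _).trans ih
    obtain ⟨R, hR⟩ := (isBounded_approxFixedPoints_translate h u
      (δ := ‖g 0‖ + 1) (by positivity)).exists_norm_le
    exact exists_fixedPoint_of_isBounded_orbit hX hg fun n => hR _ (horb n)
  · have hx' : f x + u = x := hx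
    change ‖f x + u - x‖ ≤ 1
    rw [hx', sub_self, norm_zero]
    exact zero_le_one

end Nonexpansive

/-! ### Limits along rays when the range is dense -/

section Dense

variable {X : Type*} [NormedAddCommGroup X] [NormedSpace ℝ X]

/-- Displacements decrease along a ray when tested against a functional norming its direction. -/
theorem apply_displacement_antitone {f : X → X} (hf : LipschitzWith 1 f) {φ : StrongDual ℝ X}
    (hφ : ‖φ‖ ≤ 1) {x : X} (hx : ‖x‖ = 1) (hφx : φ x = 1) :
    Antitone fun t : ℝ => φ (f (t • x) - t • x) := by
  intro s t hst
  have h := apply_displacement_le hf hφ (t • x) (s • x)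
  rw [← sub_smul, map_smul, norm_smul, hx, hφx, Real.norm_of_nonneg (by linarith)] at h
  simpa using h

/-- A weak* limit of functionals norming `r x - y` as `r → ∞` norms `x` and asymptotically norms
the vectors `s x - y`; it minimizes `y` among the functionals norming `x`. -/
theorem exists_norming_asymptotic {x : X} (hx : ‖x‖ = 1) (y : X) :
    ∃ ψ : StrongDual ℝ X, ‖ψ‖ ≤ 1 ∧ ψ x = 1 ∧
      ∀ ε > 0, ∃ s : ℝ, ‖s • x - y‖ ≤ ψ (s • x - y) + ε := by
  choose φ hφ hφn using fun r : ℕ => exists_dual_vector'' ℝ ((r : ℝ) • x - y)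
  set U : Ultrafilter ℕ := Ultrafilter.of atTop
  have hU : (U : Filter ℕ) ≤ atTop := Ultrafilter.of_le atTop
  obtain ⟨ψ, hψ, hlim⟩ := exists_weakStar_limit U φ hφ
  set q : ℝ → ℝ := fun s => ‖s • x - y‖ - s
  have hq : ∀ s, 0 ≤ s → -‖y‖ ≤ q s := fun s hs => by
    have := norm_sub_norm_le (s • x) y
    rw [norm_smul, hx, Real.norm_of_nonneg hs] at this
    simp only [q]; linarith
  have hbdd : BddBelow (q '' Set.Ici 0) := ⟨-‖y‖, by rintro _ ⟨s, hs, rfl⟩; exact hq s hs⟩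
  set p := sInf (q '' Set.Ici 0)
  -- `q` decreases to `p`, since `φ r` norms `r x - y` and grows at most like `r` along `x`
  have hlow : ∀ s : ℝ, s + p ≤ ψ (s • x - y) := by
    intro s
    refine ge_of_tendsto (hlim _) ?_
    filter_upwards [hU (eventually_ge_atTop ⌈s⌉₊)] with r hr
    have hsr : s ≤ r := (Nat.le_ceil s).trans (by exact_mod_cast hr)
    have h1 : p ≤ q r := csInf_le hbdd ⟨r, Set.mem_Ici.2 (Nat.cast_nonneg r), rfl⟩
    have h2 := le_norm_of_norm_le_one (hφ r) (((r : ℝ) - s) • x)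
    rw [norm_smul, hx, Real.norm_of_nonneg (by linarith)] at h2
    have h3 : s • x - y = ((r : ℝ) • x - y) - ((r : ℝ) - s) • x := by rw [sub_smul]; abel
    have h4 : φ r ((r : ℝ) • x - y) = ‖(r : ℝ) • x - y‖ := hφn r
    rw [h3, map_sub, h4]
    simp only [q] at h1
    linarith
  have hψx : ψ x ≤ 1 := hx ▸ le_norm_of_norm_le_one hψ x
  refine ⟨ψ, hψ, le_antisymm hψx ?_, fun ε hε => ?_⟩
  · by_contra! hlt
    have h1 := hlow ((|p + ψ y| + 1) / (1 - ψ x))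
    rw [map_sub, map_smul, smul_eq_mul] at h1
    have h2 : (|p + ψ y| + 1) / (1 - ψ x) * (1 - ψ x) = |p + ψ y| + 1 :=
      div_mul_cancel₀ _ (by linarith)
    linarith [neg_abs_le (p + ψ y)]
  · obtain ⟨_, ⟨s, hs, rfl⟩, hlt⟩ := exists_lt_of_csInf_lt (Set.nonempty_Ici.image q)
      (show sInf (q '' Set.Ici 0) < p + ε by simp only [p]; linarith)
    refine ⟨s, ?_⟩
    simp only [q] at hlt
    linarith [hlow s]

theorem DenseDisplacement.exists_apply_le {f : X → X} (hf : LipschitzWith 1 f)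
    (h : DenseDisplacement f) {x : X} (hx : ‖x‖ = 1) (M : ℝ) :
    ∃ φ : StrongDual ℝ X, ‖φ‖ ≤ 1 ∧ φ x = 1 ∧ ∃ s : ℝ, φ (f (s • x) - s • x) ≤ M := by
  -- of the slack `2`, one unit is lost in approximating `(M - 2) x` and one in norming `s x - y`
  obtain ⟨_, ⟨y, rfl⟩, hy⟩ := Metric.mem_closure_iff.1 (h ((M - 2) • x)) 1 one_pos
  obtain ⟨ψ, hψ, hψx, hs⟩ := exists_norming_asymptotic hx y
  obtain ⟨s, hs⟩ := hs 1 one_pos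
  refine ⟨ψ, hψ, hψx, s, ?_⟩
  have h1 := apply_displacement_le hf hψ (s • x) y
  rw [dist_comm, dist_eq_norm] at hy
  have h2 := le_norm_of_norm_le_one hψ (f y - y - (M - 2) • x)
  rw [map_sub, map_smul, hψx, smul_eq_mul, mul_one] at h2
  linarith

theorem hasSum_half_pow_succ : HasSum (fun n : ℕ => ((1 : ℝ) / 2) ^ (n + 1)) 1 := by
  have h := hasSum_geometric_two.mul_right (1 / 2 : ℝ)
  norm_num at h
  simpa only [pow_succ, one_div] using! h

/-- The dual unit ball is closed under infinite convex combinations. -/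
theorem exists_hasSum_convexCombination {φ : ℕ → StrongDual ℝ X} (hφ : ∀ n, ‖φ n‖ ≤ 1) :
    ∃ Φ : StrongDual ℝ X, ‖Φ‖ ≤ 1 ∧
      ∀ w, HasSum (fun n => ((1 : ℝ) / 2) ^ (n + 1) * φ n w) (Φ w) := by
  have hnorm : ∀ n, ‖((1 : ℝ) / 2) ^ (n + 1) • φ n‖ ≤ ((1 : ℝ) / 2) ^ (n + 1) := fun n => by
    rw [norm_smul, Real.norm_of_nonneg (by positivity)]
    exact mul_le_of_le_one_right (by positivity) (hφ n)
  obtain ⟨Φ, hΦ⟩ := Summable.of_norm_bounded hasSum_half_pow_succ.summable hnorm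
  refine ⟨Φ, hΦ.norm_le_of_bounded hasSum_half_pow_succ hnorm, fun w => ?_⟩
  have h := hΦ.mapL (ContinuousLinearMap.apply ℝ ℝ w)
  simpa only [ContinuousLinearMap.apply_apply, smul_apply, smul_eq_mul] using h

/-- An infinite convex combination of norming functionals with ever lower limits works. -/
theorem DenseDisplacement.directionalLimits {f : X → X} (hf : LipschitzWith 1 f)
    (h : DenseDisplacement f) : DirectionalLimits f := by
  intro x hx
  -- the factor `2 ^ (n + 1)` compensates for the weights of the convex combination below
  choose φ hφ hφx s hs using fun n : ℕ => h.exists_apply_le hf hx (‖f 0‖ - 2 ^ (n + 1) * n)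
  have hgeo := hasSum_half_pow_succ
  obtain ⟨Φ, hΦ1, happ⟩ := exists_hasSum_convexCombination hφ
  have hΦx : Φ x = 1 := by
    have h1 := happ x
    simp only [hφx, mul_one] at h1
    exact h1.unique hgeo
  refine ⟨Φ, (mem_dualityMap_iff hx).2 ⟨hΦ1, hΦx⟩, ?_⟩
  refine tendsto_atBot.2 fun b => ?_
  obtain ⟨N, hN⟩ := exists_nat_ge (‖f 0‖ - b)
  filter_upwards [eventually_ge_atTop 0, eventually_ge_atTop (s N)] with t ht0 htN
  have h0 : ∀ n, φ n (f (t • x) - t • x) ≤ ‖f 0‖ := fun n => by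
    have h1 := apply_displacement_antitone hf (hφ n) hx (hφx n) ht0
    simp only [zero_smul, sub_zero] at h1
    exact h1.trans (le_norm_of_norm_le_one (hφ n) _)
  have hNt : φ N (f (t • x) - t • x) ≤ ‖f 0‖ - 2 ^ (N + 1) * N :=
    (apply_displacement_antitone hf (hφ N) hx (hφx N) htN).trans (hs N)
  have hle : Φ (f (t • x) - t • x) ≤ 1 * ‖f 0‖ - N := by
    refine hasSum_le (fun n => ?_) (happ _)
      ((hgeo.mul_right ‖f 0‖).sub (hasSum_ite_eq N (N : ℝ)))
    split_ifs with hn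
    · subst hn
      calc _ ≤ (1 / 2 : ℝ) ^ (n + 1) * (‖f 0‖ - 2 ^ (n + 1) * n) := by gcongr
        _ = (1 / 2 : ℝ) ^ (n + 1) * ‖f 0‖ - n := by
          rw [mul_sub, ← mul_assoc, ← mul_pow]; norm_num
    · rw [sub_zero]
      have := h0 n
      gcongr
  linarith

end Dense

/-! ### Reflexivity and the minimum property in uniformly smooth spaces -/

section UniformlySmooth

variable {X : Type*} [NormedAddCommGroup X] [NormedSpace ℝ X]

theorem exists_lt_apply_of_lt_norm {φ : StrongDual ℝ X} {c : ℝ} (hc : c < ‖φ‖) :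
    ∃ w, ‖w‖ ≤ 1 ∧ c < φ w := by
  obtain ⟨w, hw, h⟩ := ContinuousLinearMap.exists_lt_apply_of_lt_opNorm φ hc
  rcases le_total 0 (φ w) with h0 | h0
  · exact ⟨w, hw.le, by rwa [Real.norm_of_nonneg h0] at h⟩
  · exact ⟨-w, by rw [norm_neg]; exact hw.le, by rwa [Real.norm_of_nonpos h0, ← map_neg] at h⟩

/-- A two-functional form of Helly's theorem: if `Φ` has distance at least `r` from the line spanned
by `Ψ`, then the unit ball contains vectors `y` with `Φ y` almost `r` and `Ψ y` almost `0`. -/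
theorem exists_apply_gt_of_le_norm_sub {Φ Ψ : StrongDual ℝ X} {r : ℝ} (hr : 0 ≤ r)
    (hΦ : ∀ c : ℝ, r ≤ ‖Φ - c • Ψ‖) {ε : ℝ} (hε : 0 < ε) :
    ∃ y : X, ‖y‖ ≤ 1 ∧ r - ε < Φ y ∧ |Ψ y| < ε := by
  set T : X →L[ℝ] ℝ × ℝ := Φ.prod Ψ with hT
  have hconv : Convex ℝ (T '' closedBall 0 1) :=
    (convex_closedBall 0 1).linear_image T.toLinearMap
  by_cases hmem : ((r, 0) : ℝ × ℝ) ∈ closure (T '' closedBall 0 1)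
  · obtain ⟨_, ⟨y, hy, rfl⟩, hd⟩ := Metric.mem_closure_iff.1 hmem ε hε
    rw [Prod.dist_eq, max_lt_iff] at hd
    obtain ⟨h1, h2⟩ := hd
    refine ⟨y, by simpa using hy, ?_, ?_⟩
    · have h3 : |r - Φ y| < ε := h1
      linarith [(abs_lt.1 h3).2]
    · have h3 : |0 - Ψ y| < ε := h2
      rwa [zero_sub, abs_neg] at h3
  · exfalso
    obtain ⟨F, c, hF, hc⟩ := geometric_hahn_banach_closed_point hconv.closure isClosed_closure hmem
    have hFpq : ∀ p q : ℝ, F (p, q) = p * F (1, 0) + q * F (0, 1) := fun p q => by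
      rw [← smul_eq_mul, ← smul_eq_mul, ← map_smul, ← map_smul, ← map_add]
      simp
    set a := F (1, 0)
    set b := F (0, 1)
    have hball : ∀ y : X, ‖y‖ ≤ 1 → Φ y * a + Ψ y * b < c := fun y hy => by
      have := hF (T y) (subset_closure ⟨y, by simpa using hy, rfl⟩)
      rwa [show T y = (Φ y, Ψ y) from rfl, hFpq] at this
    rw [hFpq] at hc
    have hc0 : 0 < c := by simpa using hball 0 (by simp)
    have ha : 0 < a := by
      by_contra! ha
      nlinarith [mul_nonneg hr (neg_nonneg.2 ha)]
    have hlt : c / a < ‖Φ - (-(b / a)) • Ψ‖ := by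
      refine lt_of_lt_of_le ?_ (hΦ _)
      rw [div_lt_iff₀ ha]
      linarith
    obtain ⟨y, hy, hlt⟩ := exists_lt_apply_of_lt_norm hlt
    have h1 := hball y hy
    rw [sub_apply, smul_apply, smul_eq_mul, div_lt_iff₀ ha] at hlt
    have h2 : (Φ y - -(b / a) * Ψ y) * a = Φ y * a + Ψ y * b := by field_simp; ring
    linarith

theorem isClosed_range_inclusionInDoubleDual [CompleteSpace X] :
    IsClosed (Set.range (NormedSpace.inclusionInDoubleDual ℝ X)) :=
  IsComplete.isClosed
    (NormedSpace.inclusionInDoubleDualLi (E := X) ℝ).isometry.isUniformInducing.isComplete_range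

/-- Riesz's lemma for the range of an operator. -/
theorem exists_norm_eq_one_le_norm_sub {Z : Type*} [NormedAddCommGroup Z] [NormedSpace ℝ Z]
    (T : X →L[ℝ] Z) (hT : IsClosed (Set.range T)) (hns : ¬ Function.Surjective T) {r : ℝ}
    (hr : r < 1) : ∃ Φ : Z, ‖Φ‖ = 1 ∧ ∀ z, r ≤ ‖Φ - T z‖ := by
  obtain ⟨Φ', hΦ'⟩ := not_forall.1 hns
  obtain ⟨Φ, hΦ, hd⟩ := riesz_lemma (F := LinearMap.range T.toLinearMap) hT ⟨Φ', hΦ'⟩ hr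
  have hn : 0 < ‖Φ‖ := norm_pos_iff.2 fun h => hΦ (h ▸ Submodule.zero_mem _)
  refine ⟨‖Φ‖⁻¹ • Φ, by rw [norm_smul, norm_inv, norm_norm, inv_mul_cancel₀ hn.ne'], fun z => ?_⟩
  have h1 := hd (T (‖Φ‖ • z)) ⟨_, rfl⟩
  have h2 : ‖Φ‖⁻¹ • Φ - T z = ‖Φ‖⁻¹ • (Φ - T (‖Φ‖ • z)) := by
    rw [smul_sub, map_smul, smul_smul, inv_mul_cancel₀ hn.ne', one_smul]
  rw [h2, norm_smul, norm_inv, norm_norm, inv_mul_eq_div, le_div_iff₀ hn]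
  exact h1

/-- A form of the Milman–Pettis theorem: a closed norming subspace of the dual of a uniformly convex
space is the whole dual. If not, by Riesz's lemma some unit functional `Φ` is almost at distance
one from the subspace. The slice of the unit ball where `Φ` is almost one is small by uniform
convexity, yet it contains a vector at which some unit functional of the subspace is almost one,
and a vector at which this functional nearly vanishes. -/
theorem surjective_of_norming_of_uniformConvexSpace {Y : Type*} [NormedAddCommGroup Y]
    [NormedSpace ℝ Y] [UniformConvexSpace Y] (T : X →L[ℝ] StrongDual ℝ Y)
    (hT : IsClosed (Set.range T))
    (hnorming : ∀ (y : Y) (c : ℝ), c < ‖y‖ → ∃ x, ‖T x‖ ≤ 1 ∧ c < T x y) :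
    Function.Surjective T := by
  obtain ⟨δ, hδ, huc⟩ := exists_forall_closed_ball_dist_add_le_two_sub Y
    (show (0 : ℝ) < 1 / 2 by norm_num)
  obtain ⟨ε, hε0, hε8, hεδ⟩ : ∃ ε : ℝ, 0 < ε ∧ ε ≤ 1 / 8 ∧ ε ≤ δ / 8 :=
    ⟨min (1 / 8) (δ / 8), by positivity, min_le_left _ _, min_le_right _ _⟩
  by_contra hns
  obtain ⟨Φ, hΦn, hdist⟩ := exists_norm_eq_one_le_norm_sub T hT hns (show 1 - ε < 1 by linarith)
  obtain ⟨y₀, hy₀, hΦy₀⟩ := exists_lt_apply_of_lt_norm (φ := Φ) (c := 1 - 2 * ε) (by linarith)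
  have hy₀' : 1 - 2 * ε < ‖y₀‖ := hΦy₀.trans_le (le_norm_of_norm_le_one hΦn.le y₀)
  obtain ⟨x, hx, hxy⟩ := hnorming y₀ _ hy₀'
  obtain ⟨y, hy, hΦy, hyx⟩ := exists_apply_gt_of_le_norm_sub (Φ := Φ) (Ψ := T x)
    (r := 1 - ε) (by linarith)
    (fun c => by rw [← map_smul]; exact hdist _) hε0
  have h1 : (1 : ℝ) / 2 ≤ ‖y₀ - y‖ := by
    have h2 := le_norm_of_norm_le_one hx (y₀ - y)
    rw [map_sub] at h2
    linarith [(abs_lt.1 hyx).2]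
  have h3 := huc hy₀ hy h1
  -- both vectors lie in the slice, so their sum is too long for the distance in `h1`
  have h4 := le_norm_of_norm_le_one hΦn.le (y₀ + y)
  rw [map_add] at h4
  linarith

/-- A uniformly smooth Banach space is reflexive. -/
theorem inclusionInDoubleDual_surjective [CompleteSpace X] [UniformConvexSpace (StrongDual ℝ X)] :
    Function.Surjective (NormedSpace.inclusionInDoubleDual ℝ X) := by
  refine surjective_of_norming_of_uniformConvexSpace _ isClosed_range_inclusionInDoubleDual
    fun y c hc => ?_
  obtain ⟨x, hx, hxy⟩ := exists_lt_apply_of_lt_norm hc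
  exact ⟨x, (NormedSpace.double_dual_bound ℝ X x).trans hx, hxy⟩

theorem exists_norm_eq_one_apply_eq_norm [CompleteSpace X] [UniformConvexSpace (StrongDual ℝ X)]
    {φ : StrongDual ℝ X} (hφ : φ ≠ 0) : ∃ z, ‖z‖ = 1 ∧ φ z = ‖φ‖ := by
  obtain ⟨Φ, hΦ, hΦφ⟩ := exists_dual_vector ℝ φ (norm_ne_zero_iff.2 hφ)
  obtain ⟨z, rfl⟩ := inclusionInDoubleDual_surjective Φ
  refine ⟨z, ?_, by simpa using hΦφ⟩
  rw [← hΦ]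
  exact ((NormedSpace.inclusionInDoubleDualLi (E := X) ℝ).norm_map z).symm

/-- In a smooth space a unit vector has only one norming functional. -/
theorem eq_of_norming [StrictConvexSpace ℝ (StrongDual ℝ X)] {φ ψ : StrongDual ℝ X}
    (hφ : ‖φ‖ ≤ 1) (hψ : ‖ψ‖ ≤ 1) {x : X} (hx : ‖x‖ = 1) (hφx : φ x = 1) (hψx : ψ x = 1) :
    φ = ψ := by
  have h1 := norm_eq_one_of_apply_eq_one hφ hx hφx
  have h2 := norm_eq_one_of_apply_eq_one hψ hx hψx
  refine eq_of_norm_eq_of_norm_add_eq (h1.trans h2.symm) (le_antisymm (norm_add_le _ _) ?_)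
  have h3 := (φ + ψ).le_opNorm x
  rw [add_apply, hφx, hψx, hx, mul_one, Real.norm_of_nonneg (by norm_num)] at h3
  linarith

/-- The minimum property of the range of `f - id`: if all displacements have norm at least `d`,
then a single functional in the dual unit ball is at least `d` on all of them. It is a limit of
functionals norming the approximate fixed points `x = s f(x)`, which escape to infinity in the
direction of their displacement; uniform convexity of the dual makes these functionals
insensitive to a change of the base point. -/
theorem exists_le_apply_displacement [CompleteSpace X] [UniformConvexSpace (StrongDual ℝ X)]
    {f : X → X} (hf : LipschitzWith 1 f) {d : ℝ} (hd : 0 < d) (h : ∀ x, d ≤ ‖f x - x‖) :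
    ∃ φ : StrongDual ℝ X, ‖φ‖ ≤ 1 ∧ ∀ x, d ≤ φ (f x - x) := by
  -- `x = s f(x)` with `s = (n + 1) / (n + 2)`
  have hex : ∀ n : ℕ, ∃ x, f x - x = ((n : ℝ) + 1)⁻¹ • x := fun n => by
    obtain ⟨x, hx⟩ := exists_eq_smul_apply hf (s := ((n : ℝ) + 1) / (n + 2)) (by positivity)
      (by rw [div_lt_one (by positivity)]; linarith)
    refine ⟨x, ?_⟩
    have h1 : f x = (((n : ℝ) + 2) / (n + 1)) • x := by
      conv_rhs => rw [hx]
      rw [smul_smul, div_mul_div_cancel₀ (by positivity), div_self (by positivity), one_smul]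
    have h2 : ((n : ℝ) + 2) / (n + 1) = ((n : ℝ) + 1)⁻¹ + 1 := by field_simp; ring
    rw [h1, h2, add_smul, one_smul, add_sub_cancel_right]
  choose x hx using hex
  have hxn : ∀ n : ℕ, d * (n + 1) ≤ ‖x n‖ := fun n => by
    have h1 := h (x n)
    rw [hx, norm_smul, norm_inv, Real.norm_of_nonneg (by positivity), inv_mul_eq_div,
      le_div_iff₀ (by positivity)] at h1
    exact h1
  choose φ hφ hφx using fun n => exists_dual_vector'' ℝ (x n)
  have hφx' : ∀ n, φ n (x n) = ‖x n‖ := hφx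
  set U : Ultrafilter ℕ := Ultrafilter.of atTop
  have hU : (U : Filter ℕ) ≤ atTop := Ultrafilter.of_le atTop
  obtain ⟨Φ, hΦ, hlim⟩ := exists_weakStar_limit U φ hφ
  refine ⟨Φ, hΦ, fun z => ?_⟩
  -- compare the functional norming `x n` with the one norming `x n - z`
  have key : ∀ ε > 0, d - ε - ε * ‖f z - z‖ ≤ Φ (f z - z) := by
    intro ε hε
    obtain ⟨δ, hδ, huc⟩ := exists_forall_closed_ball_dist_add_le_two_sub (StrongDual ℝ X) hε
    refine ge_of_tendsto (hlim _) ?_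
    have hbig : ∀ c : ℝ, ∀ᶠ n : ℕ in (U : Filter ℕ), c < n := fun c =>
      hU (tendsto_natCast_atTop_atTop.eventually_gt_atTop c)
    filter_upwards [hbig (2 * ‖z‖ / ε), hbig (2 * ‖z‖ / (δ * d))] with n hn1 hn2
    rw [div_lt_iff₀ hε] at hn1
    rw [div_lt_iff₀ (by positivity)] at hn2
    obtain ⟨ψ, hψ, hψx⟩ := exists_dual_vector'' ℝ (x n - z)
    have hψx' : ψ (x n - z) = ‖x n - z‖ := hψx
    have h1 := apply_displacement_le hf hψ (x n) z
    rw [hψx', sub_self, add_zero, hx, map_smul, smul_eq_mul, inv_mul_eq_div,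
      div_le_iff₀ (by positivity)] at h1
    have h2 := norm_sub_norm_le (x n) z
    have h3 := neg_norm_le_of_norm_le_one hψ z
    have h4 : ψ (x n) = ‖x n - z‖ + ψ z := by rw [← hψx', map_sub]; ring
    have h5 := hxn n
    -- both functionals nearly norm `x n`, so their sum has norm close to `2`
    have hclose : ‖φ n - ψ‖ < ε := by
      by_contra! hge
      have h6 := (φ n + ψ).le_of_opNorm_le (huc (hφ n) hψ hge) (x n)
      rw [add_apply, hφx', h4, Real.norm_eq_abs] at h6
      have h7 := le_abs_self (‖x n‖ + (‖x n - z‖ + ψ z))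
      have h8 : δ * (d * (n + 1)) ≤ δ * ‖x n‖ := by gcongr
      have h9 : 0 < δ * d := by positivity
      linarith
    have h10 := (ψ - φ n).le_opNorm (f z - z)
    rw [norm_sub_rev, sub_apply, Real.norm_eq_abs] at h10
    have h11 : ‖φ n - ψ‖ * ‖f z - z‖ ≤ ε * ‖f z - z‖ := by gcongr
    have h12 := le_abs_self (ψ (f z - z) - φ n (f z - z))
    have h13 : d - ε ≤ ψ (f z - z) := by
      by_contra! hlt
      have : ψ (f z - z) * ((n : ℝ) + 1) < (d - ε) * (n + 1) := by gcongr
      linarith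
    linarith
  refine le_of_forall_pos_le_add fun η hη => ?_
  have hpos : 0 < 1 + ‖f z - z‖ := by positivity
  have h1 := key (η / (1 + ‖f z - z‖)) (by positivity)
  have h2 : η / (1 + ‖f z - z‖) * (1 + ‖f z - z‖) = η := div_mul_cancel₀ _ hpos.ne'
  linarith

theorem DirectionalLimits.denseDisplacement [CompleteSpace X] (hX : IsUniformlySmooth X)
    {f : X → X} (hf : LipschitzWith 1 f) (h : DirectionalLimits f) : DenseDisplacement f := by
  have : UniformConvexSpace (StrongDual ℝ X) := hX
  refine denseDisplacement_of_forall_translate fun u ε hε => ?_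
  by_contra! hcon
  obtain ⟨φ, -, hφ⟩ := exists_le_apply_displacement (lipschitzWith_add_const hf u) hε hcon
  have hφ0 : φ ≠ 0 := by
    rintro rfl
    have := hφ 0
    simp only [zero_apply] at this
    linarith
  have hn : 0 < ‖φ‖ := norm_pos_iff.2 hφ0
  obtain ⟨z, hz, hφz⟩ := exists_norm_eq_one_apply_eq_norm hφ0
  obtain ⟨ψ, hψ, hlim⟩ := h z hz
  rw [mem_dualityMap_iff hz] at hψ
  have heq : ψ = ‖φ‖⁻¹ • φ := by
    refine eq_of_norming hψ.1 ?_ hz hψ.2 ?_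
    · rw [norm_smul, norm_inv, norm_norm, inv_mul_cancel₀ hn.ne']
    · rw [smul_apply, hφz, smul_eq_mul, inv_mul_cancel₀ hn.ne']
  obtain ⟨t, ht⟩ := (hlim.eventually_lt_atBot (‖φ‖⁻¹ * (-φ u))).exists
  rw [heq, smul_apply, smul_eq_mul] at ht
  have h1 := lt_of_mul_lt_mul_left ht (by positivity)
  have h2 := hφ (t • z)
  rw [add_sub_right_comm, map_add] at h2
  linarith

end UniformlySmooth

/-! ### Bounded fixed point sets in Hilbert spaces -/

section Hilbert

/-- Monotonicity of `id - f` and surjectivity of `f - id` make each fixed point set weakly bounded,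
hence bounded by the uniform boundedness principle. -/
theorem SurjectiveDisplacement.boundedFixedPointsOfTranslates_of_inner {H : Type*}
    [NormedAddCommGroup H] [InnerProductSpace ℝ H] [CompleteSpace H] {f : H → H}
    (hf : LipschitzWith 1 f) (h : SurjectiveDisplacement f) : BoundedFixedPointsOfTranslates f := by
  intro u
  refine ⟨?_, ?_⟩
  · obtain ⟨x, hx⟩ := h (-u)
    refine ⟨x, ?_⟩
    have hx' : f x - x = -u := hx
    change f x + u = x
    rw [sub_eq_iff_eq_add.1 hx']
    abel
  · have key : ∀ v : H, ∃ c : ℝ, ∀ x ∈ Function.fixedPoints (fun x => f x + u),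
        c ≤ inner ℝ x v := by
      intro v
      obtain ⟨y, hy⟩ := h (v - u)
      have hy' : f y - y = v - u := hy
      refine ⟨inner ℝ y v, fun x hx => ?_⟩
      have hx' : f x + u = x := hx
      have h1 : f x - f y = (x - y) - v := by
        rw [sub_eq_iff_eq_add.1 hy']
        nth_rw 2 [← hx']
        abel
      have h2 := (real_inner_le_norm (x - y) (f x - f y)).trans
        (mul_le_mul_of_nonneg_left (norm_map_sub_le hf x y) (norm_nonneg _))
      rw [h1, inner_sub_right, real_inner_self_eq_norm_mul_norm, inner_sub_left x y v] at h2
      linarith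
    obtain ⟨C, hC⟩ := banach_steinhaus
      (g := fun x : Function.fixedPoints (fun x => f x + u) => innerSL ℝ (x : H)) fun v => by
        obtain ⟨c, hc⟩ := key v
        obtain ⟨c', hc'⟩ := key (-v)
        refine ⟨max (-c) (-c'), fun x => ?_⟩
        have h1 := hc x x.2
        have h2 := hc' x x.2
        rw [inner_neg_right] at h2
        rw [innerSL_apply_apply, Real.norm_eq_abs]
        exact abs_le.2 ⟨by linarith [le_max_left (-c) (-c')], by linarith [le_max_right (-c) (-c')]⟩
    exact isBounded_iff_forall_norm_le.2 ⟨C, fun x hx => by simpa using! hC ⟨x, hx⟩⟩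

theorem SurjectiveDisplacement.boundedFixedPointsOfTranslates {X : Type*} [NormedAddCommGroup X]
    [NormedSpace ℝ X] [CompleteSpace X] (hX : IsInnerProduct X) {f : X → X}
    (hf : LipschitzWith 1 f) (h : SurjectiveDisplacement f) : BoundedFixedPointsOfTranslates f := by
  obtain ⟨I, -⟩ := hX
  exact boundedFixedPointsOfTranslates_of_inner hf h

end Hilbert

/-! ### Finite-dimensional spaces with a smooth or polyhedral norm -/

section FiniteDimensional

variable {X : Type*} [NormedAddCommGroup X]

theorem exists_ultrafilter_of_not_isBounded {s : Set X} (hs : ¬ Bornology.IsBounded s) :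
    ∃ U : Ultrafilter X, s ∈ U ∧ ∀ c : ℝ, ∀ᶠ x in (U : Filter X), c < ‖x‖ := by
  have hne : (Bornology.cobounded X ⊓ 𝓟 s).NeBot := by
    rw [inf_principal_neBot_iff]
    intro t ht
    by_contra hcon
    rw [Set.not_nonempty_iff_eq_empty] at hcon
    refine hs ((Bornology.isBounded_compl_iff.2 ht).subset fun x hx hxt => ?_)
    exact hcon.subset ⟨hxt, hx⟩
  refine ⟨Ultrafilter.of (Bornology.cobounded X ⊓ 𝓟 s), ?_, fun c => ?_⟩
  · exact Ultrafilter.of_le _ (mem_inf_of_right (mem_principal_self s))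
  · exact (Ultrafilter.of_le _).trans inf_le_left
      (tendsto_norm_cobounded_atTop.eventually_gt_atTop c)

variable [NormedSpace ℝ X]

/-- A compact convex set has the fixed point property for nonexpansive maps: the displacement
attains its minimum, and contractions close to `g` show that this minimum is zero. -/
theorem hasFixedPointProperty_of_finiteDimensional [FiniteDimensional ℝ X] :
    HasFixedPointProperty X := by
  have : ProperSpace X := FiniteDimensional.proper_real X
  intro C hne hcl hbdd hconv g hg
  have hcomp : IsCompact C := isCompact_of_isClosed_isBounded hcl hbdd
  have : CompactSpace C := isCompact_iff_compactSpace.1 hcomp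
  have hneC : Nonempty C := hne.to_subtype
  have c : C := hneC.some
  obtain ⟨D, hD⟩ := hbdd.subset_closedBall (c : X)
  obtain ⟨p, -, hp⟩ := isCompact_univ.exists_isMinOn (Set.univ_nonempty (α := C))
    (f := fun x => dist (g x) x) (hg.continuous.dist continuous_id).continuousOn
  refine ⟨p, ?_⟩
  by_contra hpne
  have hpos : 0 < dist (g p) p := dist_pos.2 hpne
  have hM : 0 < |D| + 1 := by positivity
  obtain ⟨τ, hτ0, hτ1, hτ⟩ : ∃ τ : ℝ, 0 < τ ∧ τ < 1 ∧ τ * (|D| + 1) < dist (g p) p := by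
    refine ⟨min (1 / 2) (dist (g p) p / (2 * (|D| + 1))), by positivity,
      (min_le_left _ _).trans_lt (by norm_num), ?_⟩
    calc _ ≤ dist (g p) p / (2 * (|D| + 1)) * (|D| + 1) := by gcongr; exact min_le_right _ _
      _ = dist (g p) p / 2 := by field_simp
      _ < dist (g p) p := by linarith
  -- the fixed point of a contraction towards `c` has too small a displacement
  set T : C → C := fun x => ⟨τ • (c : X) + (1 - τ) • (g x : X),
    hconv c.2 (g x).2 hτ0.le (by linarith) (by ring)⟩ with hT
  have hTc : ContractingWith ⟨1 - τ, by linarith⟩ T := by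
    refine ⟨by exact_mod_cast show 1 - τ < 1 by linarith,
      LipschitzWith.of_dist_le_mul fun a b => ?_⟩
    rw [Subtype.dist_eq, dist_add_left, dist_smul₀, Real.norm_of_nonneg (by linarith),
      ← Subtype.dist_eq]
    exact mul_le_mul_of_nonneg_left (by simpa using hg.dist_le_mul a b) (by linarith)
  set q := hTc.fixedPoint
  have hq : (q : X) = τ • (c : X) + (1 - τ) • (g q : X) :=
    (congrArg Subtype.val hTc.fixedPoint_isFixedPt.eq).symm
  have h1 : dist (g q) q = τ * dist (g q : X) c := by
    rw [Subtype.dist_eq, dist_eq_norm, dist_eq_norm]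
    conv_lhs => rw [hq]
    have : (g q : X) - (τ • (c : X) + (1 - τ) • (g q : X)) = τ • ((g q : X) - c) := by
      rw [sub_smul, smul_sub, one_smul]; abel
    rw [this, norm_smul, Real.norm_of_nonneg hτ0.le]
  have h2 : dist (g q : X) c ≤ |D| + 1 := by
    have := mem_closedBall.1 (hD (g q).2)
    linarith [le_abs_self D]
  have h3 : dist (g p) p ≤ dist (g q) q := hp (Set.mem_univ q)
  rw [h1] at h3
  have h4 : τ * dist (g q : X) c ≤ τ * (|D| + 1) := by gcongr
  linarith

/-- Along approximate fixed points escaping to infinity in the limit direction `e`, the functionals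
norming `x - t e` tend to the unique functional norming `e`. -/
theorem DirectionalLimits.boundedApproxFixedPoints_of_isSmooth [FiniteDimensional ℝ X]
    (hX : IsSmooth X) {f : X → X} (hf : LipschitzWith 1 f) (h : DirectionalLimits f) :
    BoundedApproxFixedPoints f := by
  have : ProperSpace X := FiniteDimensional.proper_real X
  have : StrictConvexSpace ℝ (StrongDual ℝ X) := hX
  intro δ hδ
  by_contra hnb
  obtain ⟨U, hFU, hU⟩ := exists_ultrafilter_of_not_isBounded hnb
  obtain ⟨e, -, he⟩ := (isCompact_closedBall (0 : X) 1).ultrafilter_le_nhds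
    (U.map fun x => ‖x‖⁻¹ • x) (by
      rw [le_principal_iff, Ultrafilter.mem_coe, Ultrafilter.mem_map]
      refine Filter.univ_mem' fun x => ?_
      simpa [norm_smul] using! inv_mul_le_one (a := ‖x‖))
  replace he : Tendsto (fun x => ‖x‖⁻¹ • x) U (𝓝 e) := he
  have he1 : ‖e‖ = 1 := by
    refine tendsto_nhds_unique he.norm (tendsto_const_nhds.congr' ?_)
    filter_upwards [hU 0] with x hx
    rw [norm_smul, norm_inv, norm_norm, inv_mul_cancel₀ hx.ne']
  obtain ⟨φ, hφ, hlim⟩ := h e he1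
  rw [mem_dualityMap_iff he1] at hφ
  obtain ⟨t, ht⟩ := (hlim.eventually_lt_atBot (-δ)).exists
  choose ψ hψ hψn using fun x => exists_dual_vector'' ℝ (x - t • e)
  obtain ⟨Ψ, hΨ, hΨlim⟩ := exists_weakStar_limit U ψ hψ
  have hΨe : Ψ e = 1 := by
    refine le_antisymm (he1 ▸ le_norm_of_norm_le_one hΨ e) ?_
    have hinv : Tendsto (fun x : X => ‖x‖⁻¹) U (𝓝 0) :=
      tendsto_inv_atTop_zero.comp (tendsto_atTop.2 fun c => (hU c).mono fun _ hx => hx.le)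
    have hsub : Tendsto (fun x => ‖e - ‖x‖⁻¹ • x‖) U (𝓝 0) := by
      simpa using (he.const_sub e).norm
    have hlow : Tendsto (fun x => 1 - 2 * |t| * ‖x‖⁻¹ - ‖e - ‖x‖⁻¹ • x‖) U (𝓝 1) := by
      simpa using! ((hinv.const_mul (2 * |t|)).const_sub 1).sub hsub
    refine le_of_tendsto_of_tendsto hlow (hΨlim e) ?_
    filter_upwards [hU 0] with x hx
    have h1 : ψ x (x - t • e) = ‖x - t • e‖ := hψn x
    have h2 := norm_sub_norm_le x (t • e)
    have h3 := neg_norm_le_of_norm_le_one (hψ x) (t • e)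
    rw [norm_smul, he1, mul_one, Real.norm_eq_abs] at h2 h3
    rw [map_sub] at h1
    have h4 : ‖x‖ - 2 * |t| ≤ ψ x x := by linarith
    have h5 := neg_norm_le_of_norm_le_one (hψ x) (e - ‖x‖⁻¹ • x)
    rw [map_sub, map_smul, smul_eq_mul] at h5
    have h6 : ‖x‖⁻¹ * (‖x‖ - 2 * |t|) ≤ ‖x‖⁻¹ * ψ x x := by gcongr
    rw [mul_sub, inv_mul_cancel₀ hx.ne'] at h6
    linarith
  have heq : Ψ = φ := eq_of_norming hΨ hφ.1 he1 hΨe hφ.2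
  have hge : -δ ≤ Ψ (f (t • e) - t • e) := by
    refine ge_of_tendsto (hΨlim _) ?_
    filter_upwards [hFU] with x hx
    have h1 := apply_displacement_le hf (hψ x) x (t • e)
    have h2 : ψ x (x - t • e) = ‖x - t • e‖ := hψn x
    have h3 := neg_norm_le_of_norm_le_one (hψ x) (f x - x)
    have h4 : ‖f x - x‖ ≤ δ := hx
    linarith
  rw [heq] at hge
  linarith

/-- Every vector is a nonnegative combination of extreme points of the unit ball, with the norm as
sum of the coefficients. -/
theorem exists_extremePoints_combination [FiniteDimensional ℝ X] {E : Finset X}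
    (hE : (E : Set X) = Set.extremePoints ℝ (closedBall (0 : X) 1)) (x : X) :
    ∃ a : X → ℝ, (∀ k ∈ E, 0 ≤ a k) ∧ ∑ k ∈ E, a k = ‖x‖ ∧ ∑ k ∈ E, a k • k = x := by
  have : ProperSpace X := FiniteDimensional.proper_real X
  rcases eq_or_ne x 0 with rfl | hx
  · exact ⟨0, by simp⟩
  have hn : 0 < ‖x‖ := norm_pos_iff.2 hx
  have hball := closure_convexHull_extremePoints (isCompact_closedBall (0 : X) 1)
    (convex_closedBall 0 1)
  rw [← hE, (E.finite_toSet.isClosed_convexHull ℝ).closure_eq] at hball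
  have hmem : ‖x‖⁻¹ • x ∈ convexHull ℝ (E : Set X) := by
    rw [hball, mem_closedBall_zero_iff, norm_smul, norm_inv, norm_norm, inv_mul_cancel₀ hn.ne']
  obtain ⟨w, hw0, hw1, hwx⟩ := Finset.mem_convexHull'.1 hmem
  refine ⟨fun k => ‖x‖ * w k, fun k hk => mul_nonneg hn.le (hw0 k hk), ?_, ?_⟩
  · rw [← Finset.mul_sum, hw1, mul_one]
  · simp_rw [mul_smul]
    rw [← Finset.smul_sum, hwx, smul_smul, mul_inv_cancel₀ hn.ne', one_smul]

/-- If approximate fixed points `x` escape to infinity, write them as nonnegative combinations of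
extreme points and let `y` be the sum of those extreme points whose coefficients are unbounded.
Each functional norming `y` norms `x` up to a constant, and moving from `x` by a fixed multiple
of `-y` decreases the norm by the same amount as it decreases such a functional; so the
displacements along the ray of `y` are bounded below. -/
theorem DirectionalLimits.boundedApproxFixedPoints_of_isPolyhedral [FiniteDimensional ℝ X]
    (hX : IsPolyhedral X) {f : X → X} (hf : LipschitzWith 1 f) (h : DirectionalLimits f) :
    BoundedApproxFixedPoints f := by
  classical
  intro δ hδ
  by_contra hnb
  obtain ⟨U, hFU, hU⟩ := exists_ultrafilter_of_not_isBounded hnb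
  set E : Finset X := Set.Finite.toFinset hX
  have hE : (E : Set X) = Set.extremePoints ℝ (closedBall (0 : X) 1) := Set.Finite.coe_toFinset hX
  have hE1 : ∀ k ∈ E, ‖k‖ ≤ 1 := fun k hk => by
    have : k ∈ (E : Set X) := hk
    rw [hE] at this
    simpa using this.1
  choose a ha0 hasum hax using exists_extremePoints_combination hE
  set K := E.filter fun k => ∀ c : ℝ, ∀ᶠ x in (U : Filter X), c < a x k with hK
  have hKE : K ⊆ E := Finset.filter_subset _ _
  have hKtop : ∀ k ∈ K, ∀ c : ℝ, ∀ᶠ x in (U : Filter X), c < a x k := fun k hk =>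
    (Finset.mem_filter.1 hk).2
  have hbound : ∀ k ∈ E \ K, ∃ c : ℝ, ∀ᶠ x in (U : Filter X), a x k ≤ c := fun k hk => by
    rw [Finset.mem_sdiff, hK, Finset.mem_filter, not_and] at hk
    obtain ⟨c, hc⟩ := not_forall.1 (hk.2 hk.1)
    exact ⟨c, by simpa using Ultrafilter.eventually_not.2 hc⟩
  choose! B hB using hbound
  set C := ∑ k ∈ E \ K, B k
  have hC : ∀ᶠ x in (U : Filter X), ∑ k ∈ E \ K, a x k ≤ C := by
    filter_upwards [(Finset.eventually_all (E \ K)).2 hB] with x hx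
    exact Finset.sum_le_sum hx
  have hsplit : ∀ x, ∑ k ∈ E \ K, a x k + ∑ k ∈ K, a x k = ‖x‖ := fun x => by
    rw [Finset.sum_sdiff hKE, hasum]
  have hKne : K.Nonempty := by
    by_contra hne
    rw [Finset.not_nonempty_iff_eq_empty] at hne
    obtain ⟨x, hx1, hx2⟩ := (hC.and (hU C)).exists
    have := hsplit x
    rw [hne, Finset.sum_empty] at this
    rw [hne] at hx1
    linarith
  set m : ℝ := (K.card : ℝ)
  have hm : 0 < m := Nat.cast_pos.2 hKne.card_pos
  set y₀ := ∑ k ∈ K, k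
  have happ : ∀ φ : StrongDual ℝ X, φ y₀ = ∑ k ∈ K, φ k := fun φ => map_sum φ _ _
  have hle1 : ∀ φ : StrongDual ℝ X, ‖φ‖ ≤ 1 → ∀ k ∈ E, φ k ≤ 1 := fun φ hφ k hk =>
    (le_norm_of_norm_le_one hφ k).trans (hE1 k hk)
  -- the extreme points in `K` lie on a common face of the unit ball
  have hy₀ : ‖y₀‖ = m := by
    refine le_antisymm ((norm_sum_le _ _).trans ?_) ?_
    · simpa using Finset.sum_le_card_nsmul K _ 1 fun k hk => hE1 k (hKE hk)
    · obtain ⟨x, hx⟩ := ((Finset.eventually_all K).2 fun k hk => hKtop k hk 0).exists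
      obtain ⟨φ, hφ, hφx⟩ := exists_dual_vector'' ℝ x
      have hφx' : φ x = ‖x‖ := hφx
      have hzero : ∑ k ∈ E, a x k * (1 - φ k) = 0 := by
        simp_rw [mul_sub, mul_one]
        rw [Finset.sum_sub_distrib, hasum, ← hφx']
        nth_rw 1 [← hax x]
        rw [map_sum]
        simp
      rw [Finset.sum_eq_zero_iff_of_nonneg fun k hk =>
        mul_nonneg (ha0 x k hk) (sub_nonneg.2 (hle1 φ hφ k hk))] at hzero
      have hone : ∀ k ∈ K, φ k = 1 := fun k hk => by
        have := (mul_eq_zero.1 (hzero k (hKE hk))).resolve_left (hx k hk).ne'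
        linarith
      have h1 := le_norm_of_norm_le_one hφ y₀
      rw [happ, Finset.sum_congr rfl hone] at h1
      simpa using! h1
  set y := m⁻¹ • y₀ with hy
  have hy1 : ‖y‖ = 1 := by
    rw [hy, norm_smul, hy₀, Real.norm_of_nonneg (by positivity), inv_mul_cancel₀ hm.ne']
  obtain ⟨φ, hφ, hlim⟩ := h y hy1
  rw [mem_dualityMap_iff hy1] at hφ
  obtain ⟨hφ1, hφy⟩ := hφ
  have hφK : ∀ k ∈ K, φ k = 1 := by
    have hzero : ∑ k ∈ K, (1 - φ k) = 0 := by
      rw [hy, map_smul, smul_eq_mul, inv_mul_eq_div, div_eq_one_iff_eq hm.ne', happ] at hφy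
      rw [Finset.sum_sub_distrib, hφy]
      simp [m]
    rw [Finset.sum_eq_zero_iff_of_nonneg fun k hk =>
      sub_nonneg.2 (hle1 φ hφ1 k (hKE hk))] at hzero
    exact fun k hk => by linarith [hzero k hk]
  obtain ⟨t, ht, ht0⟩ := ((hlim.eventually_lt_atBot (-δ - 2 * C)).and
    (eventually_ge_atTop 0)).exists
  obtain ⟨x, hxF, hxC, hxK⟩ := ((show ∀ᶠ x in (U : Filter X), x ∈ approxFixedPoints f δ from
    hFU).and (hC.and ((Finset.eventually_all K).2 fun k hk => hKtop k hk (t * m⁻¹)))).exists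
  have hxsplit : ∑ k ∈ E \ K, a x k • k + ∑ k ∈ K, a x k • k = x := by
    rw [Finset.sum_sdiff hKE, hax]
  -- far out, the coefficients of `x - t y` are still nonnegative
  have hnorm : ‖x - t • y‖ ≤ ‖x‖ - t := by
    have h1 : x - t • y = ∑ k ∈ E \ K, a x k • k + ∑ k ∈ K, (a x k - t * m⁻¹) • k := by
      simp_rw [sub_smul]
      rw [Finset.sum_sub_distrib, ← add_sub_assoc, hxsplit, ← Finset.smul_sum, hy, smul_smul]
    have h2 : ‖∑ k ∈ E \ K, a x k • k‖ ≤ ∑ k ∈ E \ K, a x k := by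
      refine norm_sum_le_of_le _ fun k hk => ?_
      have hkE := (Finset.mem_sdiff.1 hk).1
      rw [norm_smul, Real.norm_of_nonneg (ha0 x k hkE)]
      exact mul_le_of_le_one_right (ha0 x k hkE) (hE1 k hkE)
    have h3 : ‖∑ k ∈ K, (a x k - t * m⁻¹) • k‖ ≤ ∑ k ∈ K, (a x k - t * m⁻¹) := by
      refine norm_sum_le_of_le _ fun k hk => ?_
      have hnn : 0 ≤ a x k - t * m⁻¹ := (sub_pos.2 (hxK k hk)).le
      rw [norm_smul, Real.norm_of_nonneg hnn]
      exact mul_le_of_le_one_right hnn (hE1 k (hKE hk))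
    have h4 : ∑ k ∈ K, (a x k - t * m⁻¹) = ∑ k ∈ K, a x k - t := by
      rw [Finset.sum_sub_distrib, Finset.sum_const, nsmul_eq_mul]
      change _ - m * (t * m⁻¹) = _
      field_simp
    rw [h1]
    linarith [norm_add_le (∑ k ∈ E \ K, a x k • k) (∑ k ∈ K, (a x k - t * m⁻¹) • k), hsplit x]
  have hφx : ‖x‖ - 2 * C ≤ φ x := by
    have h1 : φ x = ∑ k ∈ E \ K, a x k * φ k + ∑ k ∈ K, a x k := by
      conv_lhs => rw [← hxsplit]
      rw [map_add, map_sum, map_sum]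
      congr 1
      · simp
      · exact Finset.sum_congr rfl fun k hk => by simp [hφK k hk]
    have h2 : -∑ k ∈ E \ K, a x k ≤ ∑ k ∈ E \ K, a x k * φ k := by
      rw [← Finset.sum_neg_distrib]
      refine Finset.sum_le_sum fun k hk => ?_
      have hkE := (Finset.mem_sdiff.1 hk).1
      have h3 := neg_norm_le_of_norm_le_one hφ1 k
      have h4 : a x k * (-1) ≤ a x k * φ k :=
        mul_le_mul_of_nonneg_left (by linarith [hE1 k hkE]) (ha0 x k hkE)
      linarith
    linarith [hsplit x]
  have h1 := apply_displacement_le hf hφ1 x (t • y)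
  have h2 := neg_norm_le_of_norm_le_one hφ1 (f x - x)
  have h3 : ‖f x - x‖ ≤ δ := hxF
  rw [map_sub φ x (t • y), map_smul, hφy, smul_eq_mul, mul_one] at h1
  linarith

end FiniteDimensional

end Displacement

theorem mainTheorem2 {X : Type*} [NormedAddCommGroup X] [NormedSpace ℝ X] [CompleteSpace X]
    (f : X → X) (hf : LipschitzWith 1 f) :
    -- implications valid in every real Banach space
    (Displacement.BoundedApproxFixedPoints f → Displacement.DenseDisplacement f) ∧
    (Displacement.BoundedFixedPointsOfTranslates f → Displacement.SurjectiveDisplacement f) ∧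
    (Displacement.DenseDisplacement f → Displacement.DirectionalLimits f) ∧
    -- spaces with the fixed point property
    (Displacement.HasFixedPointProperty X →
      Displacement.BoundedApproxFixedPoints f → Displacement.BoundedFixedPointsOfTranslates f) ∧
    -- uniformly smooth spaces
    (Displacement.IsUniformlySmooth X →
      (Displacement.DenseDisplacement f ↔ Displacement.DirectionalLimits f)) ∧
    -- Hilbert spaces
    (Displacement.IsInnerProduct X →
      (Displacement.BoundedFixedPointsOfTranslates f ↔ Displacement.SurjectiveDisplacement f)) ∧
    -- finite-dimensional spaces with a smooth or polyhedral norm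
    (FiniteDimensional ℝ X → Displacement.IsSmooth X ∨ Displacement.IsPolyhedral X →
      List.TFAE [Displacement.BoundedApproxFixedPoints f,
        Displacement.BoundedFixedPointsOfTranslates f,
        Displacement.SurjectiveDisplacement f,
        Displacement.DenseDisplacement f,
        Displacement.DirectionalLimits f]) := by
  refine ⟨fun h => h.denseDisplacement hf, fun h => h.surjectiveDisplacement,
    fun h => h.directionalLimits hf, fun hX h => h.boundedFixedPointsOfTranslates hX hf,
    fun hX => ⟨fun h => h.directionalLimits hf, fun h => h.denseDisplacement hX hf⟩,
    fun hX => ⟨fun h => h.surjectiveDisplacement, fun h =>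
      h.boundedFixedPointsOfTranslates hX hf⟩, fun hfin hX => ?_⟩
  tfae_have 1 → 2 := fun h => h.boundedFixedPointsOfTranslates
    Displacement.hasFixedPointProperty_of_finiteDimensional hf
  tfae_have 2 → 3 := fun h => h.surjectiveDisplacement
  tfae_have 3 → 4 := fun h => h.denseDisplacement
  tfae_have 4 → 5 := fun h => h.directionalLimits hf
  tfae_have 5 → 1 := fun h => hX.elim
    (fun hX => h.boundedApproxFixedPoints_of_isSmooth hX hf)
    (fun hX => h.boundedApproxFixedPoints_of_isPolyhedral hX hf)
  tfae_finish
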